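/- Let $p$ be an odd prime, let $m \ge 5$ be an odd integer, and let $k$ be a positive integer with $\gcd(m,k)=1$. Let $\mathrm{Tr}$ denote the trace from $\mathbb{F}_{p^m}$ to $\mathbb{F}_p$, and let $\zeta_p \in \mathbb{C}$ be a primitive $p$-th root of unity. For $u,v,w \in \mathbb{F}_{p^m}$ put $$D(u,v,w)=\sum_{y\in\mathbb{F}_p^*}\ \sum_{x\in\mathbb{F}_{p^m}}\zeta_p^{\,y\,\mathrm{Tr}\left(ux^2+vx^{p^k+1}+wx^{p^{2k}+1}\right)}.$$ Fix any $w\in\mathbb{F}_{p^m}^*$. Then, as $(u,v)$ runs through $\mathbb{F}_{p^m}^2$, the sum $D(u,v,w)$ takes only the values $0$, $\pm(p-1)p^{\frac{m+1}{2}}$ and $\pm(p-1)p^{\frac{m+3}{2}}$, and the number of pairs $(u,v)\in\mathbb{F}_{p^m}^2$ at which each value is taken is as follows: - $0$ is taken $p^{2m}-p^{2m-1}+p^{2m-4}-p^{m-3}$ times; - $(p-1)p^{\frac{m+1}{2}}$ is taken $\dfrac{(p^{m+2}-p^{m}-p^{m-1}+1)(p^{m-1}+p^{\frac{m-1}{2}})}{2(p^{2}-1)}$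 times; - $-(p-1)p^{\frac{m+1}{2}}$ is taken $\dfrac{(p^{m+2}-p^{m}-p^{m-1}+1)(p^{m-1}-p^{\frac{m-1}{2}})}{2(p^{2}-1)}$ times; - $(p-1)p^{\frac{m+3}{2}}$ is taken $\dfrac{(p^{m-1}-1)(p^{m-3}+p^{\frac{m-3}{2}})}{2(p^{2}-1)}$ times; - $-(p-1)p^{\frac{m+3}{2}}$ is taken $\dfrac{(p^{m-1}-1)(p^{m-3}-p^{\frac{m-3}{2}})}{2(p^{2}-1)}$ times. -/

import Mathlib

/-- The exponential sum
`D(u, v, w) = ∑_{y ∈ 𝔽_p^*} ∑_{x ∈ F} ζ ^ (y · Tr(u x² + v x^(p^k+1) + w x^(p^(2k)+1)))`,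
where `F` is a finite extension of `𝔽_p`, `Tr : F → 𝔽_p` is the trace and `ζ` is meant to be a
primitive `p`-th root of unity in `ℂ`, so that `ζ ^ a` makes sense for `a : ZMod p`; it is
computed with the representative `a.val` in `{0, …, p - 1}`. -/
noncomputable def expSumD (p : ℕ) [Fact p.Prime] (F : Type*) [Field F] [Fintype F]
    [Algebra (ZMod p) F] (k : ℕ) (ζ : ℂ) (u v w : F) : ℂ :=
  ∑ y : (ZMod p)ˣ, ∑ x : F,
    ζ ^ ((y : ZMod p) *
      Algebra.trace (ZMod p) F
        (u * x ^ 2 + v * x ^ (p ^ k + 1) + w * x ^ (p ^ (2 * k) + 1))).val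

/-- The number of pairs `(u, v) ∈ F × F` with `D(u, v, w) = z`. -/
noncomputable def freqD (p : ℕ) [Fact p.Prime] (F : Type*) [Field F] [Fintype F]
    [Algebra (ZMod p) F] (k : ℕ) (ζ : ℂ) (w : F) (z : ℂ) : ℕ :=
  Set.ncard {uv : F × F | expSumD p F k ζ uv.1 uv.2 w = z}

/-! Write `σ` for the `p ^ k`-power Frobenius, `q = p ^ m`, and `S(y)` for the inner sum of `D`, the
exponential sum of `y` times the quadratic form `Q(x) = Tr(u x² + v x σ(x) + w x σ²(x))` over `ZMod
p`.

Values. Diagonalising `Q`, of rank `r`, gives `S(y) = χ(y) ^ r * S(1)` with `χ` the quadratic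
character, and `S(1) * S(-1) = p ^ (2 * m - r)`. For odd `r` the sum over `y` cancels; for even `r`
it is `(p - 1) * S(1)` with `S(1) ^ 2 = p ^ (2 * m - r)`. The radical of `Q` is the zero set of a
skew polynomial of degree 4 in `σ`, whose fixed field is the prime field because `gcd(m, k) = 1`;
hence it has at most `p ^ 4` elements (`card_skewPolynomial_zeros_le`). As `m` is odd, an even rank
forces corank 1 or 3 (`twistedSum_dichotomy`).

Frequencies. For a nonsquare `c` of `ZMod p`, `E = (S(1) + S(c)) / 2` satisfies `D = (p - 1) * E`.
Five unknown frequencies need the moments of `E` of orders 0 to 4. By the dichotomy, powers of `E`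
are combinations of products of `S(±1)` and `S(±c)`. Summed over `(u, v)`, such a product counts
common zeros of two twisted forms; the third, with its fixed coefficient `w`, vanishes at these
zeros. The factor `S(1) * S(-1)` contributes a hyperbolic plane, and that makes the count explicit
(`sum_hyperbolic_moment`). -/

/-! ### Power moments over `(u, v)` by counting common zeros. -/

section Moments

variable {F : Type*} [Field F] [Fintype F]

/-- The form `u x² + v x σ(x) + w x σ²(x)` attached to an endomorphism `σ` of a field. -/
def twistedForm (σ : F →+* F) (w u v x : F) : F :=
  u * x ^ 2 + v * (x * σ x) + w * (x * σ (σ x))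

/-- The exponential sum of `a` times the form `twistedForm σ w u v`. -/
noncomputable def twistedSum (ψ : AddChar F ℂ) (σ : F →+* F) (w a u v : F) : ℂ :=
  ∑ x, ψ (a * twistedForm σ w u v x)

open Classical in
theorem sum_addChar_mul {ψ : AddChar F ℂ} (hψ : ψ.IsPrimitive) (b : F) :
    ∑ u, ψ (u * b) = if b = 0 then (Fintype.card F : ℂ) else 0 := by
  have := AddChar.sum_mulShift b hψ
  push_cast at this
  exact this

open Classical in
/-- Orthogonality: summing over the two linear parameters counts the common zeros. -/
theorem sum_addChar_pairs {ψ : AddChar F ℂ} (hψ : ψ.IsPrimitive) {X : Type*} [Fintype X]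
    (f₀ f₁ f₂ : X → F) (h : ∀ x, f₀ x = 0 → f₁ x = 0 → f₂ x = 0) :
    ∑ uv : F × F, ∑ x, ψ (uv.1 * f₀ x + uv.2 * f₁ x + f₂ x) =
      (Fintype.card F : ℂ) ^ 2 * ((Finset.univ.filter fun x => f₀ x = 0 ∧ f₁ x = 0).card : ℂ) := by
  rw [Finset.sum_comm, Finset.card_filter, Nat.cast_sum, Finset.mul_sum]
  refine Finset.sum_congr rfl fun x _ => ?_
  simp only [AddChar.map_add_eq_mul, ← Finset.sum_mul, Fintype.sum_prod_type, ← Finset.mul_sum]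
  rw [sum_addChar_mul hψ, sum_addChar_mul hψ]
  by_cases h0 : f₀ x = 0 <;> by_cases h1 : f₁ x = 0 <;> simp [h0, h1, sq]
  rw [h x h0 h1, AddChar.map_zero_eq_one]

theorem bijective_sub_add (h2 : (2 : F) ≠ 0) :
    Function.Bijective fun x : F × F => (x.1 - x.2, x.1 + x.2) := by
  refine Function.Injective.bijective_of_finite fun x y h => ?_
  simp only [Prod.mk.injEq] at h
  obtain ⟨h3, h4⟩ := h
  refine Prod.ext (mul_left_cancel₀ h2 ?_) (mul_left_cancel₀ h2 ?_)
  · linear_combination h3 + h4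
  · linear_combination h4 - h3

/-- For a quadratic form, the value at `a` minus the value at `b` is the polar bilinear form at `(a
- b, a + b)`, and this substitution is bijective since 2 is invertible. -/
theorem twistedSum_one_mul_neg_one (h2 : (2 : F) ≠ 0) (ψ : AddChar F ℂ) (σ : F →+* F)
    (w u v : F) :
    twistedSum ψ σ w 1 u v * twistedSum ψ σ w (-1) u v =
      ∑ x : F × F, ψ (u * (x.1 * x.2) + v * ((x.1 * σ x.2 + x.2 * σ x.1) / 2) +
        w * ((x.1 * σ (σ x.2) + x.2 * σ (σ x.1)) / 2)) := by
  rw [twistedSum, twistedSum, Finset.sum_mul_sum, ← Fintype.sum_prod_type',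
    ← (bijective_sub_add h2).sum_comp fun x => ψ (u * (x.1 * x.2) +
      v * ((x.1 * σ x.2 + x.2 * σ x.1) / 2) +
      w * ((x.1 * σ (σ x.2) + x.2 * σ (σ x.1)) / 2))]
  refine Finset.sum_congr rfl fun x _ => ?_
  rw [← AddChar.map_add_eq_mul]
  congr 1
  simp only [twistedForm, map_add, map_sub]
  field_simp
  ring

open Classical in
-- If `A = 0`, then `B` is free and only `g₀ = g₁ = 0` remains. If `A ≠ 0`, put `z = A • t`: the
-- first equation forces `B = -A * g₀ t`, and the second, divided by `A * σ A`, becomes a condition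
-- on `t` alone, the same for all `q - 1` values of `A`.
theorem card_hyperbolic_zeros (h2 : (2 : F) ≠ 0) {V : Type*} [AddCommGroup V] [Module F V]
    [Fintype V] (σ : F →+* F) (g₀ g₁ : V → F)
    (hg₀ : ∀ a z, g₀ (a • z) = a ^ 2 * g₀ z) (hg₁ : ∀ a z, g₁ (a • z) = a * σ a * g₁ z) :
    ((Finset.univ.filter fun x : (F × F) × V => x.1.1 * x.1.2 + g₀ x.2 = 0 ∧
        (x.1.1 * σ x.1.2 + x.1.2 * σ x.1.1) / 2 + g₁ x.2 = 0).card : ℂ) =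
      Fintype.card F * (Finset.univ.filter fun z => g₀ z = 0 ∧ g₁ z = 0).card +
      (Fintype.card F - 1) * (Finset.univ.filter fun t => 2 * g₁ t = g₀ t + σ (g₀ t)).card := by
  have key : ∀ A : F, ∑ B : F, ∑ z : V, (if A * B + g₀ z = 0 ∧
      (A * σ B + B * σ A) / 2 + g₁ z = 0 then (1 : ℂ) else 0) =
      if A = 0 then
        (Fintype.card F : ℂ) * (Finset.univ.filter fun z => g₀ z = 0 ∧ g₁ z = 0).card
      else ((Finset.univ.filter fun t => 2 * g₁ t = g₀ t + σ (g₀ t)).card : ℂ) := by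
    intro A
    split_ifs with hA
    · subst hA
      simp only [zero_mul, map_zero, mul_zero, add_zero, zero_div, zero_add, Finset.sum_boole,
        Finset.sum_const, Finset.card_univ, nsmul_eq_mul]
    · have hσA : σ A ≠ 0 := by simpa using hA
      rw [Finset.sum_comm, Finset.card_filter, Nat.cast_sum,
        ← (MulAction.bijective (Units.mk0 A hA)).sum_comp]
      refine Finset.sum_congr rfl fun t _ => ?_
      rw [Finset.sum_eq_single (-(A * g₀ t))]
      · have e1 : g₀ (Units.mk0 A hA • t) = A ^ 2 * g₀ t := hg₀ A t
        have e2 : g₁ (Units.mk0 A hA • t) = A * σ A * g₁ t := hg₁ A t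
        have : (A * -(A * g₀ t) + g₀ (Units.mk0 A hA • t) = 0 ∧
            (A * σ (-(A * g₀ t)) + -(A * g₀ t) * σ A) / 2 + g₁ (Units.mk0 A hA • t) = 0) ↔
            2 * g₁ t = g₀ t + σ (g₀ t) := by
          rw [e1, e2]
          have : (A * σ (-(A * g₀ t)) + -(A * g₀ t) * σ A) / 2 + A * σ A * g₁ t =
              A * σ A / 2 * (2 * g₁ t - (g₀ t + σ (g₀ t))) := by
            simp only [map_neg, map_mul]
            field_simp
            ring
          rw [this]
          constructor
          · rintro ⟨-, h⟩
            have := (mul_eq_zero.1 h).resolve_left (by simp [hA, h2])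
            linear_combination this
          · intro h
            exact ⟨by ring, by rw [h]; ring⟩
        simp only [this]
        push_cast
        rfl
      · intro B _ hB
        rw [if_neg]
        rintro ⟨h, -⟩
        have e1 : g₀ (Units.mk0 A hA • t) = A ^ 2 * g₀ t := hg₀ A t
        rw [e1] at h
        exact hB (mul_left_cancel₀ hA (by linear_combination h))
      · simp
  rw [Finset.card_filter, Nat.cast_sum, Fintype.sum_prod_type, Fintype.sum_prod_type]
  push_cast
  rw [Finset.sum_congr rfl fun A _ => key A, ← Finset.add_sum_erase _ _ (Finset.mem_univ (0 : F)),
    if_pos rfl, Finset.sum_congr rfl fun A hA => if_neg (Finset.ne_of_mem_erase hA),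
    Finset.sum_const, Finset.card_erase_of_mem (Finset.mem_univ _), Finset.card_univ, nsmul_eq_mul,
    Nat.cast_sub Fintype.card_pos, Nat.cast_one]

open Classical in
/-- The moment of `|S|²` times the exponential sum of a form `g` on `V`. -/
theorem sum_hyperbolic_moment {ψ : AddChar F ℂ} (hψ : ψ.IsPrimitive) (h2 : (2 : F) ≠ 0)
    {V : Type*} [AddCommGroup V] [Module F V] [Fintype V] (σ : F →+* F) (w : F)
    (g₀ g₁ g₂ : V → F)
    (hg₀ : ∀ a z, g₀ (a • z) = a ^ 2 * g₀ z) (hg₁ : ∀ a z, g₁ (a • z) = a * σ a * g₁ z)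
    (hg₂ : ∀ a z, g₂ (a • z) = a * σ (σ a) * g₂ z)
    (hz : ∀ z, g₀ z = 0 → g₁ z = 0 → g₂ z = 0)
    (ht : ∀ t, 2 * g₁ t = g₀ t + σ (g₀ t) → 2 * g₂ t = g₀ t + σ (σ (g₀ t))) :
    ∑ uv : F × F, twistedSum ψ σ w 1 uv.1 uv.2 * twistedSum ψ σ w (-1) uv.1 uv.2 *
        ∑ z, ψ (uv.1 * g₀ z + uv.2 * g₁ z + w * g₂ z) =
      (Fintype.card F : ℂ) ^ 2 *
      (Fintype.card F * (Finset.univ.filter fun z => g₀ z = 0 ∧ g₁ z = 0).card +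
      (Fintype.card F - 1) *
        (Finset.univ.filter fun t => 2 * g₁ t = g₀ t + σ (g₀ t)).card) := by
  rw [← card_hyperbolic_zeros h2 σ g₀ g₁ hg₀ hg₁, ← sum_addChar_pairs hψ _ _
    (fun x : (F × F) × V => w * ((x.1.1 * σ (σ x.1.2) + x.1.2 * σ (σ x.1.1)) / 2 + g₂ x.2))]
  · refine Finset.sum_congr rfl fun uv _ => ?_
    rw [twistedSum_one_mul_neg_one h2, Finset.sum_mul_sum, ← Fintype.sum_prod_type']
    refine Finset.sum_congr rfl fun x _ => ?_
    rw [← AddChar.map_add_eq_mul]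
    congr 1
    ring
  -- Since `w` is not summed over, the third form must vanish at the common zeros: this is `hz` when
  -- `A = 0`, and `ht` after rescaling by `A` otherwise.
  · rintro ⟨⟨A, B⟩, z⟩ h0 h1
    simp only at h0 h1 ⊢
    by_cases hA : A = 0
    · subst hA
      simp only [zero_mul, map_zero, mul_zero, add_zero, zero_div, zero_add] at h0 h1 ⊢
      rw [hz z h0 h1, mul_zero]
    · have hσA : σ A ≠ 0 := by simpa using hA
      obtain ⟨t, rfl⟩ : ∃ t, A • t = z := ⟨A⁻¹ • z, smul_inv_smul₀ hA z⟩
      rw [hg₀] at h0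
      rw [hg₁] at h1
      rw [hg₂]
      have hB : B = -(A * g₀ t) := mul_left_cancel₀ hA (by linear_combination h0)
      subst hB
      simp only [map_neg, map_mul] at h1 ⊢
      have := ht t (mul_left_cancel₀ (mul_ne_zero hA hσA) (by
        field_simp at h1
        linear_combination h1))
      field_simp
      linear_combination w * A * σ (σ A) * this

open Classical in
theorem card_fst_or_snd {X : Type*} [Fintype X] (P : X → Prop) :
    ((Finset.univ.filter fun x : X × X => P x.1 ∨ P x.2).card : ℂ) =
      2 * Fintype.card X * (Finset.univ.filter P).card - ((Finset.univ.filter P).card : ℂ) ^ 2 := by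
  have h1 : ((Finset.univ.filter fun x : X × X => P x.1 ∧ P x.2).card : ℂ) =
      ((Finset.univ.filter P).card : ℂ) ^ 2 := by
    rw [← Finset.univ_product_univ, Finset.filter_product, Finset.card_product]
    push_cast; ring
  have h2 : ((Finset.univ.filter fun x : X × X => P x.1).card : ℂ) =
      Fintype.card X * (Finset.univ.filter P).card := by
    rw [← Finset.univ_product_univ, Finset.filter_product_left P, Finset.card_product]
    push_cast; rw [Finset.card_univ]; ring
  have h3 : ((Finset.univ.filter fun x : X × X => P x.2).card : ℂ) =
      Fintype.card X * (Finset.univ.filter P).card := by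
    rw [← Finset.univ_product_univ, Finset.filter_product_right P, Finset.card_product]
    push_cast; rw [Finset.card_univ]
  have h4 := Finset.card_union_add_card_inter (Finset.univ.filter fun x : X × X => P x.1)
    (Finset.univ.filter fun x : X × X => P x.2)
  rw [← Finset.filter_or, ← Finset.filter_and] at h4
  have h5 := congrArg (Nat.cast : ℕ → ℂ) h4
  push_cast at h5
  rw [h1, h2, h3] at h5
  linear_combination h5

variable {ψ : AddChar F ℂ} (hψ : ψ.IsPrimitive) (h2 : (2 : F) ≠ 0) (σ : F →+* F) (w : F)

include hψ in
theorem sum_twistedSum {a : F} (ha : a ≠ 0) :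
    ∑ uv : F × F, twistedSum ψ σ w a uv.1 uv.2 = (Fintype.card F : ℂ) ^ 2 := by
  classical
  have := sum_addChar_pairs hψ (fun x : F => a * x ^ 2) (fun x => a * (x * σ x))
    (fun x => a * (w * (x * σ (σ x)))) (fun x h _ => by
      have : x = 0 := by simpa [ha] using h
      simp [this])
  have hc : (Finset.univ.filter fun x : F => a * x ^ 2 = 0 ∧ a * (x * σ x) = 0) = {0} := by
    ext x; simp [ha]
  rw [hc, Finset.card_singleton, Nat.cast_one, mul_one] at this
  rw [← this]
  refine Finset.sum_congr rfl fun uv _ => Finset.sum_congr rfl fun x _ => ?_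
  rw [twistedForm]
  congr 1; ring

include hψ h2 in
theorem sum_twistedSum_one_neg_one :
    ∑ uv : F × F, twistedSum ψ σ w 1 uv.1 uv.2 * twistedSum ψ σ w (-1) uv.1 uv.2 =
      (Fintype.card F : ℂ) ^ 2 * (2 * Fintype.card F - 1) := by
  classical
  -- On a one-point space both conditions are vacuous, which leaves `q + (q - 1)`.
  have := sum_hyperbolic_moment hψ h2 (V := PUnit.{1}) σ w (fun _ => 0) (fun _ => 0) (fun _ => 0)
    (by simp) (by simp) (by simp) (by simp) (by simp)
  simp only [mul_zero, map_zero, add_zero, AddChar.map_zero_eq_one, Finset.sum_const,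
    Finset.card_univ, Fintype.card_punit, one_smul, mul_one, true_and, Finset.filter_true,
    Nat.cast_one] at this
  rw [this]; ring

omit [Fintype F] in
theorem sq_sub_mul_sq_eq_zero {c : F} (hc : ¬ IsSquare c) {x y : F} (h : x ^ 2 - c * y ^ 2 = 0) :
    x = 0 ∧ y = 0 := by
  by_cases hy : y = 0
  · subst hy; simpa using h
  · refine (hc ⟨x / y, ?_⟩).elim
    field_simp
    linear_combination -h

include hψ in
-- The form `x² - c y²` is anisotropic, so the origin is the only common zero.
theorem sum_twistedSum_one_neg_nonsquare {c : F} (hc : ¬ IsSquare c) :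
    ∑ uv : F × F, twistedSum ψ σ w 1 uv.1 uv.2 * twistedSum ψ σ w (-c) uv.1 uv.2 =
      (Fintype.card F : ℂ) ^ 2 := by
  classical
  have := sum_addChar_pairs hψ (fun x : F × F => x.1 ^ 2 - c * x.2 ^ 2)
    (fun x => x.1 * σ x.1 - c * (x.2 * σ x.2))
    (fun x => w * (x.1 * σ (σ x.1) - c * (x.2 * σ (σ x.2)))) (fun x h _ => by
      obtain ⟨h1, h2⟩ := sq_sub_mul_sq_eq_zero hc h
      simp [h1, h2])
  have hc : (Finset.univ.filter fun x : F × F => x.1 ^ 2 - c * x.2 ^ 2 = 0 ∧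
      x.1 * σ x.1 - c * (x.2 * σ x.2) = 0) = {0} := by
    ext x
    simp only [Finset.mem_filter, Finset.mem_univ, true_and, Finset.mem_singleton]
    constructor
    · rintro ⟨h, -⟩
      obtain ⟨h1, h2⟩ := sq_sub_mul_sq_eq_zero hc h
      exact Prod.ext h1 h2
    · rintro rfl; simp
  rw [hc, Finset.card_singleton, Nat.cast_one, mul_one] at this
  rw [← this]
  refine Finset.sum_congr rfl fun uv _ => ?_
  rw [twistedSum, twistedSum, Finset.sum_mul_sum, ← Fintype.sum_prod_type']
  refine Finset.sum_congr rfl fun x _ => ?_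
  rw [← AddChar.map_add_eq_mul, twistedForm, twistedForm]
  congr 1; ring

open Classical in
include hψ h2 in
-- For `g₀ t = e * t²` with `e` fixed by `σ`, the condition on `t` is `e * (σ t - t)² = 0`, so `t`
-- is a fixed point.
theorem sum_twistedSum_three {e : F} (he : e ≠ 0) (hσe : σ e = e) :
    ∑ uv : F × F, twistedSum ψ σ w 1 uv.1 uv.2 * twistedSum ψ σ w (-1) uv.1 uv.2 *
        twistedSum ψ σ w e uv.1 uv.2 =
      (Fintype.card F : ℂ) ^ 2 * (Fintype.card F +
        (Fintype.card F - 1) * (Finset.univ.filter fun t => σ t = t).card) := by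
  have fix : ∀ t : F, 2 * (e * (t * σ t)) = e * t ^ 2 + σ (e * t ^ 2) ↔ σ t = t := by
    intro t
    rw [map_mul, map_pow, hσe]
    constructor
    · intro h
      have : (σ t - t) ^ 2 = 0 := mul_left_cancel₀ he (by linear_combination -h)
      exact sub_eq_zero.1 (pow_eq_zero_iff two_ne_zero |>.1 this)
    · intro h; rw [h]; ring
  have := sum_hyperbolic_moment hψ h2 σ w (fun x : F => e * x ^ 2) (fun x => e * (x * σ x))
    (fun x => e * (x * σ (σ x))) (fun a z => by simp only [smul_eq_mul]; ring)
    (fun a z => by simp only [smul_eq_mul, map_mul]; ring)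
    (fun a z => by simp only [smul_eq_mul, map_mul]; ring)
    (fun z h _ => by
      have : z = 0 := by simpa [he] using h
      simp [this])
    (fun t h => by
      rw [fix] at h
      simp only [map_mul, map_pow, hσe, h]
      ring)
  have hc : (Finset.univ.filter fun x : F => e * x ^ 2 = 0 ∧ e * (x * σ x) = 0) = {0} := by
    ext x; simp [he]
  simp only [fix, hc, Finset.card_singleton, Nat.cast_one, mul_one] at this
  rw [← this]
  refine Finset.sum_congr rfl fun uv _ => ?_
  congr 1
  refine Finset.sum_congr rfl fun x _ => ?_
  rw [twistedForm]
  congr 1; ring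

open Classical in
include hψ h2 in
-- With a second hyperbolic plane as `V`, the condition on `t` factors as `(σ t₁ - t₁) * (σ t₂ - t₂)
-- = 0`.
theorem sum_twistedSum_four_split :
    ∑ uv : F × F, twistedSum ψ σ w 1 uv.1 uv.2 * twistedSum ψ σ w (-1) uv.1 uv.2 *
        (twistedSum ψ σ w 1 uv.1 uv.2 * twistedSum ψ σ w (-1) uv.1 uv.2) =
      (Fintype.card F : ℂ) ^ 2 * (Fintype.card F * (2 * Fintype.card F - 1) +
        (Fintype.card F - 1) *
          (2 * Fintype.card F * (Finset.univ.filter fun t => σ t = t).card -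
            ((Finset.univ.filter fun t => σ t = t).card : ℂ) ^ 2)) := by
  have fix : ∀ t : F × F, 2 * ((t.1 * σ t.2 + t.2 * σ t.1) / 2) = t.1 * t.2 + σ (t.1 * t.2) ↔
      σ t.1 = t.1 ∨ σ t.2 = t.2 := by
    intro t
    rw [map_mul, mul_div_cancel₀ _ h2]
    constructor
    · intro h
      have : (σ t.1 - t.1) * (σ t.2 - t.2) = 0 := by linear_combination -h
      simpa [sub_eq_zero] using this
    · rintro (h | h) <;> rw [h] <;> ring
  have zer : ∀ z : F × F, (z.1 * z.2 = 0 ∧ (z.1 * σ z.2 + z.2 * σ z.1) / 2 = 0) ↔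
      (z.1 = 0 ∨ z.2 = 0) := by
    intro z
    constructor
    · rintro ⟨h, -⟩; simpa using h
    · rintro (h | h) <;> simp [h]
  have := sum_hyperbolic_moment hψ h2 σ w (fun x : F × F => x.1 * x.2)
    (fun x => (x.1 * σ x.2 + x.2 * σ x.1) / 2)
    (fun x => (x.1 * σ (σ x.2) + x.2 * σ (σ x.1)) / 2)
    (fun a z => by simp only [Prod.smul_fst, Prod.smul_snd, smul_eq_mul]; ring)
    (fun a z => by simp only [Prod.smul_fst, Prod.smul_snd, smul_eq_mul, map_mul]; ring)
    (fun a z => by simp only [Prod.smul_fst, Prod.smul_snd, smul_eq_mul, map_mul]; ring)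
    (fun z h h' => by rcases (zer z).1 ⟨h, h'⟩ with h | h <;> simp [h])
    (fun t h => by
      rw [mul_div_cancel₀ _ h2]
      rcases (fix t).1 h with h | h <;> simp only [map_mul, h] <;> ring)
  simp only [fix, zer] at this
  rw [card_fst_or_snd fun t : F => t = 0, card_fst_or_snd fun t : F => σ t = t] at this
  have hc : (Finset.univ.filter fun x : F => x = 0) = {0} := by ext x; simp
  rw [hc, Finset.card_singleton, Nat.cast_one] at this
  simp only [← twistedSum_one_mul_neg_one h2] at this
  rw [this]
  ring

open Classical in
include hψ h2 in
-- Here the condition says that `x² - c y²` vanishes at `(σ t₁ - t₁, σ t₂ - t₂)`; anisotropy makes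
-- both coordinates fixed points.
theorem sum_twistedSum_four_nonsplit {c : F} (hc : ¬ IsSquare c) (hσc : σ c = c) :
    ∑ uv : F × F, twistedSum ψ σ w 1 uv.1 uv.2 * twistedSum ψ σ w (-1) uv.1 uv.2 *
        (twistedSum ψ σ w 1 uv.1 uv.2 * twistedSum ψ σ w (-c) uv.1 uv.2) =
      (Fintype.card F : ℂ) ^ 2 * (Fintype.card F +
        (Fintype.card F - 1) * ((Finset.univ.filter fun t => σ t = t).card : ℂ) ^ 2) := by
  have fix : ∀ t : F × F, 2 * (t.1 * σ t.1 - c * (t.2 * σ t.2)) =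
      (t.1 ^ 2 - c * t.2 ^ 2) + σ (t.1 ^ 2 - c * t.2 ^ 2) ↔ σ t.1 = t.1 ∧ σ t.2 = t.2 := by
    intro t
    simp only [map_sub, map_mul, map_pow, hσc]
    constructor
    · intro h
      have := sq_sub_mul_sq_eq_zero hc (x := σ t.1 - t.1) (y := σ t.2 - t.2)
        (by linear_combination -h)
      simpa [sub_eq_zero] using this
    · rintro ⟨h, h'⟩; rw [h, h']; ring
  have zer : ∀ z : F × F, (z.1 ^ 2 - c * z.2 ^ 2 = 0 ∧ z.1 * σ z.1 - c * (z.2 * σ z.2) = 0) ↔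
      z = 0 := by
    intro z
    constructor
    · rintro ⟨h, -⟩
      obtain ⟨h1, h2⟩ := sq_sub_mul_sq_eq_zero hc h
      exact Prod.ext h1 h2
    · rintro rfl; simp
  have := sum_hyperbolic_moment hψ h2 σ w (fun x : F × F => x.1 ^ 2 - c * x.2 ^ 2)
    (fun x => x.1 * σ x.1 - c * (x.2 * σ x.2))
    (fun x => x.1 * σ (σ x.1) - c * (x.2 * σ (σ x.2)))
    (fun a z => by simp only [Prod.smul_fst, Prod.smul_snd, smul_eq_mul]; ring)
    (fun a z => by simp only [Prod.smul_fst, Prod.smul_snd, smul_eq_mul, map_mul]; ring)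
    (fun a z => by simp only [Prod.smul_fst, Prod.smul_snd, smul_eq_mul, map_mul]; ring)
    (fun z h h' => by simp [(zer z).1 ⟨h, h'⟩])
    (fun t h => by
      obtain ⟨h1, h2⟩ := (fix t).1 h
      simp only [map_sub, map_mul, map_pow, hσc, h1, h2]; ring)
  simp only [fix, zer] at this
  have hc1 : (Finset.univ.filter fun x : F × F => x = 0) = {0} := by ext x; simp
  have hc2 : (Finset.univ.filter fun x : F × F => σ x.1 = x.1 ∧ σ x.2 = x.2).card =
      (Finset.univ.filter fun t => σ t = t).card ^ 2 := by
    rw [← Finset.univ_product_univ, Finset.filter_product (fun t => σ t = t) (fun t => σ t = t),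
      Finset.card_product, sq]
  rw [hc1, hc2, Finset.card_singleton, Nat.cast_one, mul_one, Nat.cast_pow] at this
  rw [← this]
  refine Finset.sum_congr rfl fun uv _ => ?_
  congr 1
  rw [twistedSum, twistedSum, Finset.sum_mul_sum, ← Fintype.sum_prod_type']
  refine Finset.sum_congr rfl fun x _ => ?_
  rw [← AddChar.map_add_eq_mul, twistedForm, twistedForm]
  congr 1; ring

end Moments

/-! ### Exponential sums of quadratic forms over finite fields of odd characteristic. -/

section QuadraticForms

variable {K : Type*} [Field K] [Fintype K] {ψ : AddChar K ℂ}

theorem sum_addChar_mul_sq [DecidableEq K] (hψ : ψ.IsPrimitive) (hK : ringChar K ≠ 2)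
    {a : K} (ha : a ≠ 0) :
    ∑ z, ψ (a * z ^ 2) = (quadraticChar K a : ℂ) * ∑ z, ψ (z ^ 2) := by
  have key : ∀ b : K, b ≠ 0 →
      ∑ z, ψ (b * z ^ 2) = (quadraticChar K b : ℂ) * ∑ t, (quadraticChar K t : ℂ) * ψ t := by
    intro b hb
    calc ∑ z, ψ (b * z ^ 2) = ∑ t, ∑ z with z ^ 2 = t, ψ (b * z ^ 2) :=
          (Finset.sum_fiberwise _ _ _).symm
      _ = ∑ t, ((quadraticChar K t : ℂ) + 1) * ψ (t * b) := by
          refine Finset.sum_congr rfl fun t _ => ?_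
          have h := quadraticChar_card_sqrts hK t
          have h' : ((Finset.univ.filter fun z : K => z ^ 2 = t).card : ℂ) =
              (quadraticChar K t : ℂ) + 1 := by
            rw [Set.toFinset_ofPred] at h
            exact_mod_cast h
          rw [← h', ← nsmul_eq_mul, ← Finset.sum_const]
          refine Finset.sum_congr rfl fun z hz => ?_
          rw [(Finset.mem_filter.1 hz).2, mul_comm]
      _ = ∑ t, (quadraticChar K t : ℂ) * ψ (t * b) := by
          simp only [add_mul, one_mul, Finset.sum_add_distrib]
          rw [sum_addChar_mul hψ, if_neg hb, add_zero]
      _ = ∑ t, (quadraticChar K b : ℂ) * ((quadraticChar K (t * b) : ℂ) * ψ (t * b)) := by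
          refine Finset.sum_congr rfl fun t _ => ?_
          have : (quadraticChar K b : ℂ) * (quadraticChar K b : ℂ) = 1 := by
            rw [← sq]; exact_mod_cast quadraticChar_sq_one hb
          rw [map_mul (quadraticChar K), Int.cast_mul]
          linear_combination -(quadraticChar K t : ℂ) * ψ (t * b) * this
      _ = _ := by
          rw [← Finset.mul_sum,
            (mulRight_bijective₀ b hb).sum_comp fun t => (quadraticChar K t : ℂ) * ψ t]
  have h1 := key 1 one_ne_zero
  simp only [one_mul, map_one, Int.cast_one] at h1
  rw [h1, key a ha]

theorem sum_addChar_sq_mul_neg (hψ : ψ.IsPrimitive) (h2 : (2 : K) ≠ 0) {a : K} (ha : a ≠ 0) :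
    (∑ z, ψ (a * z ^ 2)) * ∑ z, ψ (-a * z ^ 2) = Fintype.card K := by
  classical
  rw [Finset.sum_mul_sum, ← Fintype.sum_prod_type']
  calc _ = ∑ x : K × K, ψ (a * ((x.1 - x.2) * (x.1 + x.2))) := by
        refine Finset.sum_congr rfl fun x _ => ?_
        rw [← AddChar.map_add_eq_mul]
        congr 1; ring
    _ = ∑ x : K × K, ψ (a * (x.1 * x.2)) :=
        (bijective_sub_add h2).sum_comp fun x => ψ (a * (x.1 * x.2))
    _ = ∑ A : K, ∑ B : K, ψ (B * (a * A)) := by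
        rw [Fintype.sum_prod_type]
        refine Finset.sum_congr rfl fun A _ => Finset.sum_congr rfl fun B _ => ?_
        congr 1; ring
    _ = _ := by
        simp only [sum_addChar_mul hψ]
        simp [ha]

theorem AddChar.map_finset_sum {A M ι : Type*} [AddCommMonoid A] [CommMonoid M]
    (φ : AddChar A M) (s : Finset ι) (f : ι → A) : φ (∑ i ∈ s, f i) = ∏ i ∈ s, φ (f i) := by
  classical
  induction s using Finset.induction_on with
  | empty => simp
  | insert i s hi ih => rw [Finset.sum_insert hi, Finset.prod_insert hi, map_add_eq_mul, ih]

/-- Exponential sums of a quadratic form `Q` over a finite field of odd characteristic: with `r`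
the rank of `Q`, scaling `Q` by `y` multiplies the sum by `χ(y) ^ r`, and the product of the sums
of `Q` and `-Q` is `q ^ (2 n - r)`. -/
theorem exists_rank_sum_quadraticForm [DecidableEq K] (hψ : ψ.IsPrimitive) (hK : ringChar K ≠ 2)
    {M : Type*} [AddCommGroup M] [Module K M] [FiniteDimensional K M] [Fintype M]
    (Q : QuadraticForm K M) :
    ∃ r ≤ Module.finrank K M, (∀ y : K, y ≠ 0 →
        ∑ x, ψ (y * Q x) = (quadraticChar K y : ℂ) ^ r * ∑ x, ψ (Q x)) ∧
      (∑ x, ψ (Q x)) * ∑ x, ψ (-Q x) =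
        (Fintype.card K : ℂ) ^ (2 * Module.finrank K M - r) := by
  have h2 : (2 : K) ≠ 0 := Ring.two_ne_zero hK
  let _ : Invertible (2 : K) := invertibleOfNonzero h2
  obtain ⟨w, ⟨e⟩⟩ := QuadraticForm.equivalent_weightedSumSquares Q
  -- After diagonalisation the sum is a product over coordinates, and the rank is the number of
  -- nonzero weights. A nonzero weight contributes `χ(y)` to the scaling and `q` to the product with
  -- the sum of `-Q`; a zero weight contributes `1` and `q ^ 2`.
  set T : Finset (Fin (Module.finrank K M)) := Finset.univ.filter fun i => w i ≠ 0 with hT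
  have hS : ∀ y : K, ∑ x, ψ (y * Q x) = ∏ i, ∑ z, ψ (y * w i * z ^ 2) := by
    intro y
    rw [Fintype.prod_sum, ← e.toLinearEquiv.bijective.sum_comp]
    refine Finset.sum_congr rfl fun x _ => ?_
    rw [← AddChar.map_finset_sum]
    congr 1
    have : Q x = QuadraticMap.weightedSumSquares K w (e x) := (e.map_app x).symm
    rw [this, QuadraticMap.weightedSumSquares_apply, Finset.mul_sum]
    refine Finset.sum_congr rfl fun i _ => ?_
    change _ = y * w i * (e x i) ^ 2
    rw [smul_eq_mul]; ring
  have hTn : T.card ≤ Module.finrank K M := by simpa using Finset.card_le_univ T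
  refine ⟨T.card, hTn, fun y hy => ?_, ?_⟩
  · have h1 : ∑ x, ψ (Q x) = ∏ i, ∑ z, ψ (w i * z ^ 2) := by simpa using hS 1
    rw [hS, h1]
    have : ∀ i, ∑ z, ψ (y * w i * z ^ 2) =
        (if w i ≠ 0 then (quadraticChar K y : ℂ) else 1) * ∑ z, ψ (w i * z ^ 2) := by
      intro i
      split_ifs with hi
      · rw [sum_addChar_mul_sq hψ hK (mul_ne_zero hy hi), sum_addChar_mul_sq hψ hK hi, map_mul,
          Int.cast_mul, mul_assoc]
      · rw [not_not] at hi
        simp [hi]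
    simp only [this, Finset.prod_mul_distrib]
    rw [Finset.prod_ite]
    simp [hT]
  · have h1 : ∑ x, ψ (Q x) = ∏ i, ∑ z, ψ (w i * z ^ 2) := by simpa using hS 1
    have h3 : ∑ x, ψ (-Q x) = ∏ i, ∑ z, ψ (-w i * z ^ 2) := by simpa using hS (-1)
    rw [h1, h3, ← Finset.prod_mul_distrib]
    have : ∀ i, (∑ z, ψ (w i * z ^ 2)) * ∑ z, ψ (-w i * z ^ 2) =
        if w i ≠ 0 then (Fintype.card K : ℂ) else (Fintype.card K : ℂ) ^ 2 := by
      intro i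
      split_ifs with hi
      · exact sum_addChar_sq_mul_neg hψ h2 hi
      · rw [not_not] at hi
        simp [hi, sq]
    simp only [this]
    rw [Finset.prod_ite, Finset.prod_const, Finset.prod_const, ← pow_mul, ← pow_add]
    congr 1
    have := Finset.card_filter_add_card_filter_not (s := (Finset.univ : Finset (Fin (Module.finrank K M))))
      (fun i => w i ≠ 0)
    rw [Finset.card_univ, Fintype.card_fin] at this
    rw [hT] at hTn ⊢
    omega

end QuadraticForms

/-! ### Zeros of skew polynomials and the size of the radical. -/

section Radical

variable {F : Type*} [Field F]

/-- Abel summation. When the coefficients `b` sum to zero, it divides a skew polynomial on the right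
by `σ - 1`. -/
theorem sum_range_tail_mul_sub (b s : ℕ → F) (n : ℕ) :
    ∑ i ∈ Finset.range n, (∑ l ∈ Finset.Ioc i n, b l) * (s (i + 1) - s i) =
      ∑ i ∈ Finset.range (n + 1), b i * s i - (∑ i ∈ Finset.range (n + 1), b i) * s 0 := by
  induction n with
  | zero => simp
  | succ n ih =>
    have h1 : ∀ i ∈ Finset.range (n + 1),
        (∑ l ∈ Finset.Ioc i (n + 1), b l) * (s (i + 1) - s i) =
        (∑ l ∈ Finset.Ioc i n, b l) * (s (i + 1) - s i) + b (n + 1) * (s (i + 1) - s i) := by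
      intro i hi
      rw [← Finset.insert_Ioc_right_eq_Ioc_add_one (by grind), Finset.sum_insert (by simp)]
      ring
    rw [Finset.sum_congr rfl h1, Finset.sum_add_distrib, ← Finset.mul_sum, Finset.sum_range_sub,
      Finset.sum_range_succ, ih, Finset.sum_range_succ _ (n + 1), Finset.sum_range_succ _ (n + 1)]
    simp
    ring

variable [Fintype F]

open Classical in
/-- A nonzero skew polynomial of degree `d` in a field endomorphism `σ` has at most
`|Fix σ| ^ d` zeros. -/
theorem card_skewPolynomial_zeros_le (σ : F →+* F) (d : ℕ) (a : ℕ → F) (had : a d ≠ 0) :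
    (Finset.univ.filter fun x => ∑ i ∈ Finset.range (d + 1), a i * σ^[i] x = 0).card ≤
      (Finset.univ.filter fun t => σ t = t).card ^ d := by
  induction d generalizing a with
  | zero =>
    have : (Finset.univ.filter fun x => ∑ i ∈ Finset.range (0 + 1), a i * σ^[i] x = 0) = {0} := by
      ext x; simp [had]
    rw [this]; simp
  | succ d ih =>
    set P := (Finset.univ.filter fun t => σ t = t).card with hP
    by_cases hx : ∃ x, x ≠ 0 ∧ ∑ i ∈ Finset.range (d + 1 + 1), a i * σ^[i] x = 0
    -- Substituting `x = x₀ * z` gives coefficients `b` with sum zero, so the polynomial is one of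
    -- degree `d` evaluated at `σ z - z`.
    · obtain ⟨x₀, hx₀, hs⟩ := hx
      set b : ℕ → F := fun i => a i * σ^[i] x₀ with hb
      set c : ℕ → F := fun i => ∑ l ∈ Finset.Ioc i (d + 1), b l with hc
      have hcd : c d ≠ 0 := by
        have : c d = b (d + 1) := by simp [hc]
        rw [this, hb]
        have := (RingHom.injective (σ ^ (d + 1))).ne hx₀
        rw [map_zero, RingHom.coe_pow] at this
        exact mul_ne_zero had this
      set S := Finset.univ.filter fun y => ∑ i ∈ Finset.range (d + 1), c i * σ^[i] y = 0
      have hS : S.card ≤ P ^ d := ih c hcd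
      have hmap : (Finset.univ.filter
          fun x => ∑ i ∈ Finset.range (d + 1 + 1), a i * σ^[i] x = 0).card =
          (Finset.univ.filter fun z => σ z - z ∈ S).card := by
        symm
        refine Finset.card_bijective (fun z => x₀ * z) (mulLeft_bijective₀ x₀ hx₀) fun z => ?_
        simp only [S, Finset.mem_filter, Finset.mem_univ, true_and]
        have e1 : ∑ i ∈ Finset.range (d + 1), c i * σ^[i] (σ z - z) =
            ∑ i ∈ Finset.range (d + 1 + 1), a i * σ^[i] (x₀ * z) := by
          have h1 : ∀ i, c i * σ^[i] (σ z - z) = c i * (σ^[i + 1] z - σ^[i] z) := by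
            intro i
            rw [Function.iterate_succ_apply, iterate_map_sub]
          have h2 : ∀ i, a i * σ^[i] (x₀ * z) = b i * σ^[i] z := by
            intro i
            rw [iterate_map_mul, hb, mul_assoc]
          simp only [h1, h2]
          have := sum_range_tail_mul_sub b (fun i => σ^[i] z) (d + 1)
          rw [hs, zero_mul, sub_zero] at this
          exact this
        rw [e1]
      rw [hmap, pow_succ']
      -- The map `z ↦ σ z - z` is additive with the fixed points as kernel, so its fibres have at
      -- most `P` elements.
      calc _ ≤ P * S.card := by
            refine Finset.card_le_mul_card_image_of_maps_to (f := fun z => σ z - z)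
              (fun z hz => (Finset.mem_filter.1 hz).2) P fun y _ => ?_
            by_cases hy : ∃ z₀, σ z₀ - z₀ = y
            · obtain ⟨z₀, rfl⟩ := hy
              refine Finset.card_le_card_of_injOn (fun z => z - z₀) (fun z hz => ?_)
                (fun z _ z' _ h => sub_left_injective h)
              have := (Finset.mem_filter.1 hz).2
              simp only [Finset.coe_filter, Finset.mem_univ, true_and, Set.mem_ofPred_eq, map_sub]
              linear_combination this
            · rw [Finset.filter_eq_empty_iff.2 fun z _ h => hy ⟨z, h⟩]
              simp
        _ ≤ _ := Nat.mul_le_mul_left _ hS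
    · push Not at hx
      have h1 : (Finset.univ.filter
          fun x => ∑ i ∈ Finset.range (d + 1 + 1), a i * σ^[i] x = 0) ⊆ {0} := by
        intro x h
        rw [Finset.mem_singleton]
        by_contra h0
        exact hx x h0 (Finset.mem_filter.1 h).2
      have h3 : 0 < P := Finset.card_pos.2 ⟨0, by simp⟩
      exact (Finset.card_le_card h1).trans (by simpa using Nat.one_le_pow _ _ h3)

open Classical in
-- Invariance of `ψ` under `σ` lets every occurrence of `B` in the polar form be moved to `σ (σ B)`.
-- The other factor is then a skew polynomial of degree 4 in `A`, with leading coefficient `σ (σ w)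
-- / 2`, and the sum over `B` detects its zeros.
theorem twistedSum_one_mul_neg_one_le {ψ : AddChar F ℂ} (hψ : ψ.IsPrimitive) (h2 : (2 : F) ≠ 0)
    (σ : F →+* F) (hσ : ∀ x, ψ (σ x) = ψ x) {w : F} (hw : w ≠ 0) (u v : F) :
    ∃ N : ℕ, N ≤ (Finset.univ.filter fun t => σ t = t).card ^ 4 ∧
      twistedSum ψ σ w 1 u v * twistedSum ψ σ w (-1) u v = Fintype.card F * N := by
  set a : ℕ → F := fun i => [w / 2, σ v / 2, σ (σ u), σ (σ v) / 2, σ (σ w) / 2].getD i 0 with ha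
  refine ⟨_, card_skewPolynomial_zeros_le σ 4 a (by simpa [ha] using And.intro hw h2), ?_⟩
  have key : ∀ A B, ψ (u * (A * B) + v * ((A * σ B + B * σ A) / 2) +
        w * ((A * σ (σ B) + B * σ (σ A)) / 2)) =
      ψ (σ (σ B) * ∑ i ∈ Finset.range (4 + 1), a i * σ^[i] A) := by
    intro A B
    have e : u * (A * B) + v * ((A * σ B + B * σ A) / 2) +
        w * ((A * σ (σ B) + B * σ (σ A)) / 2) =
        u * A * B + v * A / 2 * σ B + v * B / 2 * σ A + w * A / 2 * σ (σ B) +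
          w * B / 2 * σ (σ A) := by ring
    rw [e]
    simp only [AddChar.map_add_eq_mul]
    rw [← hσ (u * A * B), ← hσ (σ (u * A * B)), ← hσ (v * A / 2 * σ B),
      ← hσ (v * B / 2 * σ A), ← hσ (σ (v * B / 2 * σ A)), ← hσ (w * B / 2 * σ (σ A)),
      ← hσ (σ (w * B / 2 * σ (σ A)))]
    simp only [← AddChar.map_add_eq_mul]
    congr 1
    simp only [ha, Finset.sum_range_succ, Finset.sum_range_zero, map_mul, map_div₀, map_ofNat,
      Function.iterate_succ_apply, Function.iterate_zero, id]
    simp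
    ring
  have hbij : Function.Bijective fun B => σ (σ B) :=
    Function.Injective.bijective_of_finite (σ.injective.comp σ.injective)
  rw [twistedSum_one_mul_neg_one h2, Fintype.sum_prod_type, Finset.card_filter, Nat.cast_sum,
    Finset.mul_sum]
  refine Finset.sum_congr rfl fun A _ => ?_
  simp only [key]
  rw [hbij.sum_comp fun C => ψ (C * ∑ i ∈ Finset.range (4 + 1), a i * σ^[i] A),
    sum_addChar_mul hψ]
  simp

end Radical

/-! ### The trace character, the Frobenius and the rank dichotomy. -/

section FiniteFieldFacts

variable {p : ℕ} {F : Type*} [Field F] [Algebra (ZMod p) F]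

theorem ringHom_algebraMap_zmod (σ : F →+* F) (c : ZMod p) :
    σ (algebraMap (ZMod p) F c) = algebraMap (ZMod p) F c :=
  RingHom.congr_fun (Subsingleton.elim (σ.comp (algebraMap (ZMod p) F)) _) c

theorem trace_ringHom [Finite F] (σ : F →+* F) (x : F) :
    Algebra.trace (ZMod p) F (σ x) = Algebra.trace (ZMod p) F x := by
  let φ : F →ₐ[ZMod p] F := { σ with commutes' := fun c => ringHom_algebraMap_zmod σ c }
  exact Algebra.trace_eq_of_algEquiv
    (AlgEquiv.ofBijective φ (Function.Injective.bijective_of_finite σ.injective)) x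

/-- The additive character `x ↦ ζ ^ Tr x`. -/
noncomputable def traceChar (p : ℕ) [Fact p.Prime] (F : Type*) [Field F] [Algebra (ZMod p) F]
    {ζ : ℂ} (hζ : IsPrimitiveRoot ζ p) : AddChar F ℂ :=
  (AddChar.zmodChar p hζ.pow_eq_one).compAddMonoidHom (Algebra.trace (ZMod p) F).toAddMonoidHom

theorem traceChar_apply [Fact p.Prime] {ζ : ℂ} (hζ : IsPrimitiveRoot ζ p) (x : F) :
    traceChar p F hζ x = AddChar.zmodChar p hζ.pow_eq_one (Algebra.trace (ZMod p) F x) := rfl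

theorem isPrimitive_zmodChar [Fact p.Prime] {ζ : ℂ} (hζ : IsPrimitiveRoot ζ p) :
    (AddChar.zmodChar p hζ.pow_eq_one).IsPrimitive :=
  AddChar.zmodChar_primitive_of_primitive_root p hζ

theorem isPrimitive_traceChar [Fact p.Prime] [Finite F] {ζ : ℂ} (hζ : IsPrimitiveRoot ζ p) :
    (traceChar p F hζ).IsPrimitive := by
  refine AddChar.IsPrimitive.of_ne_one fun h => ?_
  obtain ⟨x, hx⟩ := Algebra.trace_surjective (ZMod p) F 1
  have h1 := DFunLike.congr_fun h x
  rw [traceChar_apply, hx, AddChar.one_apply] at h1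
  exact one_ne_zero
    ((AddChar.IsPrimitive.zmod_char_eq_one_iff p (isPrimitive_zmodChar hζ) 1).1 h1)

theorem two_ne_zero_of_zmod_algebra [Fact p.Prime] (hp : p ≠ 2) : (2 : F) ≠ 0 := by
  have : CharP F p := charP_of_injective_algebraMap (algebraMap (ZMod p) F).injective p
  have := (Nat.Prime.eq_two_or_odd' (Fact.out : p.Prime)).resolve_left hp
  exact Ring.two_ne_zero (by rwa [ringChar.eq F p])

/-- The quadratic form `x ↦ Tr (u x² + v x σ(x) + w x σ²(x))`. -/
noncomputable def traceTwistedForm (p : ℕ) {F : Type*} [Field F] [Algebra (ZMod p) F]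
    (σ : F →+* F) (w u v : F) : QuadraticForm (ZMod p) F :=
  LinearMap.BilinMap.toQuadraticMap (LinearMap.mk₂ (ZMod p)
    (fun x y => Algebra.trace (ZMod p) F (x * (u * y + v * σ y + w * σ (σ y))))
    (fun x x' y => by rw [add_mul, map_add])
    (fun c x y => by rw [smul_mul_assoc, map_smul])
    (fun x y y' => by rw [← map_add]; congr 1; simp only [map_add]; ring)
    (fun c x y => by
      rw [← map_smul]; congr 1
      simp only [ZMod.map_smul, mul_smul_comm, ← smul_add]))

theorem traceTwistedForm_apply (σ : F →+* F) (w u v x : F) :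
    traceTwistedForm p σ w u v x = Algebra.trace (ZMod p) F (twistedForm σ w u v x) := by
  change Algebra.trace (ZMod p) F _ = _
  rw [twistedForm]; congr 1; ring

variable [Fact p.Prime] [Fintype F]

open Classical in
-- Under the `p`-power map such a `t` has both `m` and `k` as periods, hence period 1.
theorem card_fixed_pow {m k : ℕ} (hmk : Nat.gcd m k = 1) (hF : Fintype.card F = p ^ m) :
    (Finset.univ.filter fun t : F => t ^ p ^ k = t).card = p := by
  have : CharP F p := charP_of_injective_algebraMap (algebraMap (ZMod p) F).injective p
  have h1 : (Finset.univ.filter fun t : F => t ^ p ^ k = t) =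
      Finset.univ.filter fun t : F => t ∈ (⊥ : Subfield F) := by
    refine Finset.filter_congr fun t _ => ?_
    rw [Subfield.mem_bot_iff_pow_eq_self F p]
    have hit : ∀ n, (fun x : F => x ^ p)^[n] t = t ^ p ^ n := fun n => by rw [pow_iterate]
    constructor
    · intro h
      have h3 : Function.IsPeriodicPt (fun x : F => x ^ p) m t := by
        rw [Function.IsPeriodicPt, Function.IsFixedPt, hit, ← hF, FiniteField.pow_card]
      have h4 : Function.IsPeriodicPt (fun x : F => x ^ p) k t := by
        rw [Function.IsPeriodicPt, Function.IsFixedPt, hit, h]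
      have := h3.gcd h4
      rwa [hmk] at this
    · intro h
      rw [← hit]
      exact Function.iterate_fixed (f := fun x : F => x ^ p) h k
  rw [h1, ← Subfield.card_bot F p, Nat.card_eq_fintype_card, Fintype.card_subtype]

/-- A square root `x` of `c` would satisfy `x ^ p = -x` by Euler's criterion, hence `x ^ p ^ m = -x`
for odd `m`, whereas `x ^ p ^ m = x`. -/
theorem not_isSquare_algebraMap {m : ℕ} (hm : Odd m) (hp : p ≠ 2)
    (hF : Fintype.card F = p ^ m) {c : ZMod p} (hc : ¬ IsSquare c) :
    ¬ IsSquare (algebraMap (ZMod p) F c) := by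
  have hc0 : c ≠ 0 := by rintro rfl; exact hc IsSquare.zero
  have hodd := (Nat.Prime.eq_two_or_odd' (Fact.out : p.Prime)).resolve_left hp
  rintro ⟨x, hx⟩
  have hx0 : x ≠ 0 := by
    rintro rfl
    simp at hx
    exact hc0 hx
  have hc1 : c ^ (p / 2) = -1 :=
    ((ZMod.pow_div_two_eq_neg_one_or_one p hc0).resolve_left
      fun h => hc ((ZMod.euler_criterion p hc0).2 h))
  have h1 : x ^ p = -x := by
    have : p = 2 * (p / 2) + 1 := by obtain ⟨j, hj⟩ := hodd; omega
    rw [this, pow_succ, pow_mul, sq, ← hx, ← map_pow, hc1, map_neg, map_one, neg_one_mul]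
  have h3 : ∀ n, x ^ p ^ n = (-1) ^ n * x := by
    intro n
    induction n with
    | zero => simp
    | succ n ih =>
      rw [pow_succ p, pow_mul, ih, mul_pow, h1, ← pow_mul, mul_comm n p, pow_mul, hodd.neg_one_pow]
      ring
  have h4 := h3 m
  rw [← hF, FiniteField.pow_card, hm.neg_one_pow] at h4
  have : (2 : F) * x = 0 := by linear_combination h4
  exact hx0 ((mul_eq_zero.1 this).resolve_left (two_ne_zero_of_zmod_algebra hp))

theorem twistedSum_algebraMap {ζ : ℂ} (hζ : IsPrimitiveRoot ζ p) (σ : F →+* F) (w u v : F)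
    (y : ZMod p) :
    twistedSum (traceChar p F hζ) σ w (algebraMap (ZMod p) F y) u v =
      ∑ x, AddChar.zmodChar p hζ.pow_eq_one (y * traceTwistedForm p σ w u v x) := by
  refine Finset.sum_congr rfl fun x _ => ?_
  rw [traceChar_apply, ← Algebra.smul_def, map_smul, smul_eq_mul, traceTwistedForm_apply]

/-- The dichotomy between odd and even rank. -/
theorem twistedSum_dichotomy (hp : p ≠ 2) {m : ℕ} (hm : 5 ≤ m) (hmodd : Odd m)
    (hF : Fintype.card F = p ^ m) {ζ : ℂ} (hζ : IsPrimitiveRoot ζ p) (σ : F →+* F)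
    (hσ : ∀ [DecidableEq F], (Finset.univ.filter fun t => σ t = t).card = p)
    {w : F} (hw : w ≠ 0) (u v : F) {c : ZMod p} (hc : ¬ IsSquare c)
    {S : ZMod p → ℂ}
    (hS : ∀ y, S y = twistedSum (traceChar p F hζ) σ w (algebraMap (ZMod p) F y) u v) :
    (∑ y : (ZMod p)ˣ, S y = 0 ∧ S c = -S 1 ∧ S (-c) = -S (-1)) ∨
    (∑ y : (ZMod p)ˣ, S y = (p - 1) * S 1 ∧ S c = S 1 ∧ S (-c) = S 1 ∧ S (-1) = S 1 ∧
      (S 1 ^ 2 = (p : ℂ) ^ (m + 1) ∨ S 1 ^ 2 = (p : ℂ) ^ (m + 3))) := by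
  classical
  have hp1 := (Fact.out : p.Prime).one_lt
  have hringChar : ringChar (ZMod p) ≠ 2 := by rwa [ZMod.ringChar_zmod_n]
  have hc0 : c ≠ 0 := by rintro rfl; exact hc IsSquare.zero
  have hfin : Module.finrank (ZMod p) F = m := by
    have := Module.card_eq_pow_finrank (K := ZMod p) (V := F)
    rw [hF, ZMod.card] at this
    exact (Nat.pow_right_injective hp1 this).symm
  obtain ⟨r, hr, hy, hprod⟩ := exists_rank_sum_quadraticForm (isPrimitive_zmodChar hζ) hringChar
    (traceTwistedForm p σ w u v)
  rw [hfin] at hr hprod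
  have hS' : ∀ y, S y = ∑ x, AddChar.zmodChar p hζ.pow_eq_one
      (y * traceTwistedForm p σ w u v x) := fun y => by rw [hS, twistedSum_algebraMap]
  have hS1 : S 1 = ∑ x, AddChar.zmodChar p hζ.pow_eq_one (traceTwistedForm p σ w u v x) := by
    simp only [hS', one_mul]
  have hSy : ∀ y, y ≠ 0 → S y = (quadraticChar (ZMod p) y : ℂ) ^ r * S 1 := fun y h => by
    rw [hS', hS1, hy y h]
  have hSS : S 1 * S (-1) = (p : ℂ) ^ (2 * m - r) := by
    rw [hS1, hS']
    simp only [neg_one_mul]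
    rw [hprod, ZMod.card]
  have hχc : quadraticChar (ZMod p) c = -1 := quadraticChar_neg_one_iff_not_isSquare.2 hc
  -- Compare `p ^ (2 * m - r) = p ^ m * N` with the bound `N ≤ p ^ 4`.
  have hrank : 2 * m - r ≤ m + 4 := by
    have h2 : (2 : F) ≠ 0 := two_ne_zero_of_zmod_algebra hp
    obtain ⟨N, hN, h⟩ := twistedSum_one_mul_neg_one_le (isPrimitive_traceChar hζ) h2 σ
      (fun x => by rw [traceChar_apply, traceChar_apply, trace_ringHom]) hw u v
    have e1 := hS 1
    have e2 := hS (-1)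
    rw [map_one] at e1
    rw [map_neg, map_one] at e2
    rw [← e1, ← e2, hSS, hF] at h
    have h' : p ^ (2 * m - r) = p ^ m * N := by exact_mod_cast h
    rw [hσ] at hN
    refine (Nat.pow_le_pow_iff_right hp1).1 ?_
    rw [h', pow_add]
    exact Nat.mul_le_mul_left _ hN
  rcases Nat.even_or_odd r with he | ho
  · right
    have hS2 : ∀ y, y ≠ 0 → S y = S 1 := by
      intro y h
      rw [hSy y h]
      obtain ⟨j, rfl⟩ := he
      have : (quadraticChar (ZMod p) y : ℂ) ^ 2 = 1 := by
        exact_mod_cast quadraticChar_sq_one h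
      rw [← two_mul, pow_mul, this, one_pow, one_mul]
    refine ⟨?_, hS2 c hc0, hS2 _ (neg_ne_zero.2 hc0), hS2 _ (neg_ne_zero.2 one_ne_zero), ?_⟩
    · rw [Finset.sum_congr rfl fun (y : (ZMod p)ˣ) _ => hS2 y y.ne_zero, Finset.sum_const, Finset.card_univ,
        ZMod.card_units, nsmul_eq_mul, Nat.cast_sub hp1.le, Nat.cast_one]
    · rw [hS2 (-1) (neg_ne_zero.2 one_ne_zero), ← sq] at hSS
      rw [hSS]
      -- The exponent is even and lies between `m` and `m + 4`, with `m` odd.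
      have : 2 * m - r = m + 1 ∨ 2 * m - r = m + 3 := by
        obtain ⟨j, rfl⟩ := he
        obtain ⟨i, rfl⟩ := hmodd
        omega
      rcases this with h | h <;> simp [h]
  · left
    have hχ : ∀ y : ZMod p, y ≠ 0 →
        (quadraticChar (ZMod p) y : ℂ) ^ r = quadraticChar (ZMod p) y := by
      intro y h
      obtain ⟨j, rfl⟩ := ho
      have : (quadraticChar (ZMod p) y : ℂ) ^ 2 = 1 := by
        exact_mod_cast quadraticChar_sq_one h
      rw [pow_succ, pow_mul, this, one_pow, one_mul]
    have hS2 : ∀ y, y ≠ 0 → S y = quadraticChar (ZMod p) y * S 1 := fun y h => by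
      rw [hSy y h, hχ y h]
    refine ⟨?_, ?_, ?_⟩
    · rw [Finset.sum_congr rfl fun (y : (ZMod p)ˣ) _ => hS2 y y.ne_zero, ← Finset.sum_mul]
      have h0 := quadraticChar_sum_zero hringChar
      have h1 : ∑ y : (ZMod p)ˣ, quadraticChar (ZMod p) (y : ZMod p) = 0 := by
        rw [← h0, ← Finset.add_sum_erase _ _ (Finset.mem_univ (0 : ZMod p)), MulChar.map_zero,
          zero_add]
        refine Finset.sum_bij (fun y _ => (y : ZMod p)) (fun y _ => by simp)
          (fun y _ z _ h => Units.ext h) (fun z hz => ?_) (fun _ _ => rfl)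
        exact ⟨Units.mk0 z (Finset.ne_of_mem_erase hz), Finset.mem_univ _, rfl⟩
      have h3 : ∑ y : (ZMod p)ˣ, (quadraticChar (ZMod p) (y : ZMod p) : ℂ) = 0 := by
        exact_mod_cast h1
      rw [h3, zero_mul]
    · rw [hS2 c hc0, hχc]; simp
    · rw [hS2 _ (neg_ne_zero.2 hc0), hS2 _ (neg_ne_zero.2 one_ne_zero), ← neg_one_mul c, map_mul,
        hχc]
      push_cast; ring

theorem expSumD_eq {k : ℕ} [CharP F p] {ζ : ℂ} (hζ : IsPrimitiveRoot ζ p) (u v w : F) :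
    expSumD p F k ζ u v w = ∑ y : (ZMod p)ˣ,
      twistedSum (traceChar p F hζ) (iterateFrobenius F p k) w (algebraMap (ZMod p) F y) u v := by
  refine Finset.sum_congr rfl fun y _ => Finset.sum_congr rfl fun x _ => ?_
  rw [traceChar_apply, ← Algebra.smul_def, map_smul, smul_eq_mul, AddChar.zmodChar_apply,
    twistedForm, iterateFrobenius_def, iterateFrobenius_def]
  rw [← pow_mul, ← pow_add, ← two_mul, pow_succ' x (p ^ k), pow_succ' x (p ^ (2 * k))]

end FiniteFieldFacts

/-! ### Recovering the frequencies from the moments. -/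

section Counting

/-- Summing a function of `f`, when `f` takes only the values `0`, `±a` and `±b`. -/
theorem sum_comp_of_five_values {X : Type*} [Fintype X] (f : X → ℂ) {a b : ℝ} (ha : 0 < a)
    (hab : a < b) (hf : ∀ x, f x ∈ ({0, (a : ℂ), -(a : ℂ), (b : ℂ), -(b : ℂ)} : Set ℂ))
    (h : ℂ → ℂ) :
    ∑ x, h (f x) = ({x | f x = 0}.ncard : ℂ) * h 0 + ({x | f x = a}.ncard : ℂ) * h a +
      ({x | f x = -a}.ncard : ℂ) * h (-a) + ({x | f x = b}.ncard : ℂ) * h b +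
      ({x | f x = -b}.ncard : ℂ) * h (-b) := by
  classical
  have hn : ∀ z : ℂ, ({x | f x = z}.ncard : ℂ) * h z = ∑ x, if f x = z then h z else 0 := by
    intro z
    rw [← Finset.sum_filter, Finset.sum_const, nsmul_eq_mul, ← Set.ncard_coe_finset]
    simp
  simp only [hn, ← Finset.sum_add_distrib]
  refine Finset.sum_congr rfl fun x _ => ?_
  have n1 : (a : ℂ) ≠ 0 := by exact_mod_cast ha.ne'
  have n2 : (b : ℂ) ≠ 0 := by exact_mod_cast (ha.trans hab).ne'
  have n3 : (a : ℂ) ≠ b := by exact_mod_cast hab.ne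
  have n4 : (a : ℂ) ≠ -b := by exact_mod_cast (show a ≠ -b by linarith)
  have n5 : (a : ℂ) ≠ -a := by exact_mod_cast (show a ≠ -a by linarith)
  have n6 : (b : ℂ) ≠ -b := by exact_mod_cast (show b ≠ -b by linarith)
  have n7 : (b : ℂ) ≠ -a := by exact_mod_cast (show b ≠ -a by linarith)
  rcases hf x with e | e | e | e | e <;> rw [e] <;>
    simp [n1, n2, n3, n4, n5, n6, n7, n1.symm, n2.symm, n3.symm, n4.symm, n5.symm, n6.symm,
      n7.symm, neg_eq_iff_eq_neg]

/-- The frequencies of five values `0`, `±p³X`, `±p⁴X` are determined by the power moments. -/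
theorem frequencies_of_moments {p X N₀ N₁ N₂ M₁ M₂ : ℚ} (hp : 1 < p) (hX : 0 < X)
    (h₀ : N₀ + N₁ + N₂ + M₁ + M₂ = (p ^ 5 * X ^ 2) ^ 2)
    (h₁ : N₁ * (p ^ 3 * X) + N₂ * -(p ^ 3 * X) + M₁ * (p ^ 4 * X) + M₂ * -(p ^ 4 * X) =
      (p ^ 5 * X ^ 2) ^ 2)
    (h₂ : N₁ * (p ^ 3 * X) ^ 2 + N₂ * (-(p ^ 3 * X)) ^ 2 + M₁ * (p ^ 4 * X) ^ 2 +
      M₂ * (-(p ^ 4 * X)) ^ 2 = (p ^ 5 * X ^ 2) ^ 3)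
    (h₃ : N₁ * (p ^ 3 * X) ^ 3 + N₂ * (-(p ^ 3 * X)) ^ 3 + M₁ * (p ^ 4 * X) ^ 3 +
      M₂ * (-(p ^ 4 * X)) ^ 3 =
      (p ^ 5 * X ^ 2) ^ 2 * (p ^ 5 * X ^ 2 + (p ^ 5 * X ^ 2 - 1) * p))
    (h₄ : N₁ * (p ^ 3 * X) ^ 4 + N₂ * (-(p ^ 3 * X)) ^ 4 + M₁ * (p ^ 4 * X) ^ 4 +
      M₂ * (-(p ^ 4 * X)) ^ 4 =
      (p ^ 5 * X ^ 2) ^ 3 * (p ^ 5 * X ^ 2 + (p ^ 5 * X ^ 2 - 1) * p)) :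
    N₀ = p ^ 10 * X ^ 4 - p ^ 9 * X ^ 4 + p ^ 6 * X ^ 4 - p ^ 2 * X ^ 2 ∧
    N₁ = (p ^ 7 * X ^ 2 - p ^ 5 * X ^ 2 - p ^ 4 * X ^ 2 + 1) * (p ^ 4 * X ^ 2 + p ^ 2 * X) /
      (2 * (p ^ 2 - 1)) ∧
    N₂ = (p ^ 7 * X ^ 2 - p ^ 5 * X ^ 2 - p ^ 4 * X ^ 2 + 1) * (p ^ 4 * X ^ 2 - p ^ 2 * X) /
      (2 * (p ^ 2 - 1)) ∧
    M₁ = (p ^ 4 * X ^ 2 - 1) * (p ^ 2 * X ^ 2 + p * X) / (2 * (p ^ 2 - 1)) ∧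
    M₂ = (p ^ 4 * X ^ 2 - 1) * (p ^ 2 * X ^ 2 - p * X) / (2 * (p ^ 2 - 1)) := by
  have hp0 : p ≠ 0 := by positivity
  have hX0 : X ≠ 0 := hX.ne'
  have hp2 : 2 * (p ^ 2 - 1) ≠ 0 := by
    have : 0 < p ^ 2 - 1 := by nlinarith
    positivity
  have c (i j : ℕ) : p ^ i * X ^ j ≠ 0 := mul_ne_zero (pow_ne_zero _ hp0) (pow_ne_zero _ hX0)
  -- The system splits: moments 1 and 3 determine the differences `N₁ - N₂` and `M₁ - M₂`, moments 2
  -- and 4 the sums; the total count then gives `N₀`.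
  have hd : N₁ - N₂ + p * (M₁ - M₂) = p ^ 7 * X ^ 3 :=
    mul_left_cancel₀ (c 3 1) (by linear_combination h₁)
  have hs : N₁ + N₂ + p ^ 2 * (M₁ + M₂) = p ^ 9 * X ^ 4 :=
    mul_left_cancel₀ (c 6 2) (by linear_combination h₂)
  have hD : (M₁ - M₂) * (p ^ 2 - 1) = p ^ 5 * X ^ 3 - p * X :=
    mul_left_cancel₀ (c 10 3) (by linear_combination h₃ - p ^ 9 * X ^ 3 * hd)
  have hS : (M₁ + M₂) * (p ^ 2 - 1) = p ^ 6 * X ^ 4 - p ^ 2 * X ^ 2 :=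
    mul_left_cancel₀ (c 14 4) (by linear_combination h₄ - p ^ 12 * X ^ 4 * hs)
  refine ⟨?_, ?_, ?_, ?_, ?_⟩
  · linear_combination h₀ - hs + hS
  · rw [eq_div_iff hp2]
    linear_combination (p ^ 2 - 1) * (hs + hd) - p ^ 2 * hS - p * hD
  · rw [eq_div_iff hp2]
    linear_combination (p ^ 2 - 1) * (hs - hd) - p ^ 2 * hS + p * hD
  · rw [eq_div_iff hp2]
    linear_combination hS + hD
  · rw [eq_div_iff hp2]
    linear_combination hS - hD

end Counting

/-! ### Assembly of the value set and the frequencies. -/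

theorem lemma4p2 (p : ℕ) [Fact p.Prime] (hp : p ≠ 2)
    (m k : ℕ) (hm : 5 ≤ m) (hmodd : Odd m) (hk : 0 < k) (hmk : Nat.gcd m k = 1)
    (F : Type*) [Field F] [Fintype F] [Algebra (ZMod p) F] (hF : Fintype.card F = p ^ m)
    (ζ : ℂ) (hζ : IsPrimitiveRoot ζ p) (w : F) (hw : w ≠ 0) :
    (∀ u v : F,
      expSumD p F k ζ u v w ∈
        ({0,
          ((p : ℂ) - 1) * (p : ℂ) ^ ((m + 1) / 2),
          -(((p : ℂ) - 1) * (p : ℂ) ^ ((m + 1) / 2)),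
          ((p : ℂ) - 1) * (p : ℂ) ^ ((m + 3) / 2),
          -(((p : ℂ) - 1) * (p : ℂ) ^ ((m + 3) / 2))} : Set ℂ)) ∧
    (freqD p F k ζ w 0 : ℚ) =
      (p : ℚ) ^ (2 * m) - (p : ℚ) ^ (2 * m - 1) + (p : ℚ) ^ (2 * m - 4) - (p : ℚ) ^ (m - 3) ∧
    (freqD p F k ζ w (((p : ℂ) - 1) * (p : ℂ) ^ ((m + 1) / 2)) : ℚ) =
      ((p : ℚ) ^ (m + 2) - (p : ℚ) ^ m - (p : ℚ) ^ (m - 1) + 1) *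
        ((p : ℚ) ^ (m - 1) + (p : ℚ) ^ ((m - 1) / 2)) / (2 * ((p : ℚ) ^ 2 - 1)) ∧
    (freqD p F k ζ w (-(((p : ℂ) - 1) * (p : ℂ) ^ ((m + 1) / 2))) : ℚ) =
      ((p : ℚ) ^ (m + 2) - (p : ℚ) ^ m - (p : ℚ) ^ (m - 1) + 1) *
        ((p : ℚ) ^ (m - 1) - (p : ℚ) ^ ((m - 1) / 2)) / (2 * ((p : ℚ) ^ 2 - 1)) ∧
    (freqD p F k ζ w (((p : ℂ) - 1) * (p : ℂ) ^ ((m + 3) / 2)) : ℚ) =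
      ((p : ℚ) ^ (m - 1) - 1) *
        ((p : ℚ) ^ (m - 3) + (p : ℚ) ^ ((m - 3) / 2)) / (2 * ((p : ℚ) ^ 2 - 1)) ∧
    (freqD p F k ζ w (-(((p : ℂ) - 1) * (p : ℂ) ^ ((m + 3) / 2))) : ℚ) =
      ((p : ℚ) ^ (m - 1) - 1) *
        ((p : ℚ) ^ (m - 3) - (p : ℚ) ^ ((m - 3) / 2)) / (2 * ((p : ℚ) ^ 2 - 1)) := by
  classical
  have hchar : CharP F p := charP_of_injective_algebraMap (algebraMap (ZMod p) F).injective p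
  have hp1 := (Fact.out : p.Prime).one_lt
  have h2 : (2 : F) ≠ 0 := two_ne_zero_of_zmod_algebra hp
  -- With `X = p ^ n` one has `q = p ^ 5 * X ^ 2`, and the nonzero values of `E` are `±p ^ 3 * X`
  -- and `±p ^ 4 * X`.
  obtain ⟨n, rfl⟩ : ∃ n, m = 2 * n + 5 := by
    obtain ⟨j, rfl⟩ := hmodd
    exact ⟨j - 2, by omega⟩
  obtain ⟨c, hc⟩ := FiniteField.exists_nonsquare (F := ZMod p) (by rwa [ZMod.ringChar_zmod_n])
  set σ := iterateFrobenius F p k with hσdef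
  set ψ := traceChar p F hζ with hψdef
  have hψ : ψ.IsPrimitive := isPrimitive_traceChar hζ
  set c' := algebraMap (ZMod p) F c with hc'def
  have hc' : ¬ IsSquare c' := not_isSquare_algebraMap hmodd hp hF hc
  have hc'0 : c' ≠ 0 := by intro h; exact hc' (h ▸ IsSquare.zero)
  have hσc : σ c' = c' := ringHom_algebraMap_zmod σ c
  have hfix : ∀ [DecidableEq F], (Finset.univ.filter fun t => σ t = t).card = p := by
    intro _
    rw [← card_fixed_pow (p := p) hmk hF]
    congr
  set S : F × F → ZMod p → ℂ :=
    fun uv y => twistedSum ψ σ w (algebraMap (ZMod p) F y) uv.1 uv.2 with hS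
  -- Averaging over a square and a nonsquare multiplier kills the odd ranks and keeps `S(1)` for the
  -- even ones.
  set E : F × F → ℂ := fun uv => (S uv 1 + S uv c) / 2 with hE
  have hdich := fun uv : F × F =>
    twistedSum_dichotomy hp hm hmodd hF hζ σ hfix hw uv.1 uv.2 hc (S := S uv) fun y => rfl
  have hDE : ∀ uv : F × F, expSumD p F k ζ uv.1 uv.2 w = (p - 1) * E uv := by
    intro uv
    rw [expSumD_eq hζ]
    change ∑ y : (ZMod p)ˣ, S uv y = _
    rcases hdich uv with ⟨h, h', -⟩ | ⟨h, h', -⟩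
    · rw [h, hE]; simp only [h']; ring
    · rw [h, hE]; simp only [h']; ring
  -- In these expressions for the powers of `E` the two products cancel for odd rank and agree for
  -- even rank. In degrees 3 and 4 each product contains the hyperbolic factor `S(1) * S(-1)`.
  have hE2 : ∀ uv, E uv ^ 2 = (S uv 1 * S uv (-1) + S uv 1 * S uv (-c)) / 2 := by
    intro uv
    rcases hdich uv with ⟨-, h, h'⟩ | ⟨-, h, h', h'', -⟩
    · simp only [hE, h, h']; ring
    · simp only [hE, h, h', h'']; ring
  have hE3 : ∀ uv, E uv ^ 3 =
      (S uv 1 * S uv (-1) * S uv 1 + S uv 1 * S uv (-1) * S uv c) / 2 := by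
    intro uv
    rcases hdich uv with ⟨-, h, h'⟩ | ⟨-, h, h', h'', -⟩
    · simp only [hE, h]; ring
    · simp only [hE, h, h'']; ring
  have hE4 : ∀ uv, E uv ^ 4 =
      (S uv 1 * S uv (-1) * (S uv 1 * S uv (-1)) +
        S uv 1 * S uv (-1) * (S uv 1 * S uv (-c))) / 2 := by
    intro uv
    rcases hdich uv with ⟨-, h, h'⟩ | ⟨-, h, h', h'', -⟩
    · simp only [hE, h, h']; ring
    · simp only [hE, h, h', h'']; ring
  have hpR : (1 : ℝ) < p := by exact_mod_cast hp1
  set a : ℝ := (p : ℝ) ^ (n + 3) with ha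
  set b : ℝ := (p : ℝ) ^ (n + 4) with hb
  have ha0 : 0 < a := by positivity
  have hab : a < b := pow_lt_pow_right₀ hpR (by omega)
  have haC : (a : ℂ) = (p : ℂ) ^ (n + 3) := by rw [ha]; push_cast; rfl
  have hbC : (b : ℂ) = (p : ℂ) ^ (n + 4) := by rw [hb]; push_cast; rfl
  have hval : ∀ uv, E uv ∈ ({0, (a : ℂ), -(a : ℂ), (b : ℂ), -(b : ℂ)} : Set ℂ) := by
    intro uv
    simp only [Set.mem_insert_iff, Set.mem_singleton_iff]
    rcases hdich uv with ⟨-, h, -⟩ | ⟨-, h, -, -, h'⟩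
    · left; simp only [hE, h]; ring
    · have hE1 : E uv = S uv 1 := by simp only [hE, h]; ring
      rw [hE1]
      right
      rcases h' with h' | h'
      · have : S uv 1 ^ 2 = (a : ℂ) ^ 2 := by rw [h', haC]; ring
        rcases sq_eq_sq_iff_eq_or_eq_neg.1 this with h | h <;> simp [h]
      · have : S uv 1 ^ 2 = (b : ℂ) ^ 2 := by rw [h', hbC]; ring
        rcases sq_eq_sq_iff_eq_or_eq_neg.1 this with h | h <;> simp [h]
  have e1 : (2 * n + 5 + 1) / 2 = n + 3 := by omega
  have e2 : (2 * n + 5 + 3) / 2 = n + 4 := by omega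
  have e3 : (2 * n + 5 - 1) / 2 = n + 2 := by omega
  have e4 : (2 * n + 5 - 3) / 2 = n + 1 := by omega
  have e5 : 2 * n + 5 - 1 = 2 * n + 4 := by omega
  have e6 : 2 * n + 5 - 3 = 2 * n + 2 := by omega
  have e7 : 2 * (2 * n + 5) - 1 = 4 * n + 9 := by omega
  have e8 : 2 * (2 * n + 5) - 4 = 4 * n + 6 := by omega
  rw [e1, e2, e3, e4, e5, e6, e7, e8, ← haC, ← hbC]
  have hpC : (p : ℂ) - 1 ≠ 0 := by
    rw [sub_ne_zero]; exact_mod_cast hp1.ne'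
  have hfreq : ∀ z : ℂ, freqD p F k ζ w ((p - 1) * z) = {uv | E uv = z}.ncard := by
    intro z
    rw [freqD]
    congr 1
    ext uv
    simp only [Set.mem_ofPred_eq, hDE]
    exact mul_right_inj' hpC
  have hmom := fun h : ℂ → ℂ => sum_comp_of_five_values E ha0 hab hval h
  have hq : (Fintype.card F : ℂ) = (p : ℂ) ^ 5 * ((p : ℂ) ^ n) ^ 2 := by
    rw [hF]; push_cast; ring
  have haX : (a : ℂ) = (p : ℂ) ^ 3 * (p : ℂ) ^ n := by rw [haC]; ring
  have hbX : (b : ℂ) = (p : ℂ) ^ 4 * (p : ℂ) ^ n := by rw [hbC]; ring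
  have hS1 : ∀ uv, S uv 1 = twistedSum ψ σ w 1 uv.1 uv.2 := fun uv => by simp [hS]
  have hSn : ∀ uv, S uv (-1) = twistedSum ψ σ w (-1) uv.1 uv.2 := fun uv => by simp [hS]
  have hSc : ∀ uv, S uv c = twistedSum ψ σ w c' uv.1 uv.2 := fun uv => rfl
  have hSnc : ∀ uv, S uv (-c) = twistedSum ψ σ w (-c') uv.1 uv.2 := fun uv => by simp [hS, hc'def]
  have M0 := hmom fun _ => 1
  have M1 := hmom fun z => z
  have M2 := hmom fun z => z ^ 2
  have M3 := hmom fun z => z ^ 3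
  have M4 := hmom fun z => z ^ 4
  simp only [hE2, hE3, hE4, hS1, hSn, hSc, hSnc, ← Finset.sum_div, Finset.sum_add_distrib]
    at M2 M3 M4
  have hEsum : ∑ uv, E uv = (Fintype.card F : ℂ) ^ 2 := by
    simp only [hE, hS1, hSc, ← Finset.sum_div, Finset.sum_add_distrib]
    rw [sum_twistedSum hψ σ w one_ne_zero, sum_twistedSum hψ σ w hc'0]
    ring
  rw [hEsum] at M1
  rw [sum_twistedSum_one_neg_one hψ h2, sum_twistedSum_one_neg_nonsquare hψ σ w hc'] at M2
  rw [sum_twistedSum_three hψ h2 σ w one_ne_zero (map_one σ),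
    sum_twistedSum_three hψ h2 σ w hc'0 hσc, hfix] at M3
  -- The split and nonsplit counts contain `-p ^ 2` and `p ^ 2` with the same factor, so these terms
  -- cancel in the average.
  rw [sum_twistedSum_four_split hψ h2, sum_twistedSum_four_nonsplit hψ h2 σ w hc' hσc, hfix] at M4
  have hcardX : (∑ _uv : F × F, (1 : ℂ)) = (Fintype.card F : ℂ) ^ 2 := by
    simp [Fintype.card_prod, sq]
  rw [hcardX] at M0
  rw [hq, haX, hbX] at M0 M1 M2 M3 M4
  have f0 := hfreq 0
  have f1 := hfreq a
  have f2 := hfreq (-a)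
  have f3 := hfreq b
  have f4 := hfreq (-b)
  rw [mul_zero] at f0
  rw [mul_neg] at f2 f4
  rw [haX] at f1 f2
  rw [hbX] at f3 f4
  rw [haX, hbX, f0, f1, f2, f3, f4]
  refine ⟨fun u v => ?_, ?_⟩
  · rw [hDE (u, v)]
    have := hval (u, v)
    rw [haX, hbX] at this
    simp only [Set.mem_insert_iff, Set.mem_singleton_iff] at this ⊢
    rcases this with h | h | h | h | h <;> simp [h]
  · generalize {uv | E uv = 0}.ncard = N₀ at *
    generalize {uv | E uv = (p : ℂ) ^ 3 * (p : ℂ) ^ n}.ncard = N₁ at *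
    generalize {uv | E uv = -((p : ℂ) ^ 3 * (p : ℂ) ^ n)}.ncard = N₂ at *
    generalize {uv | E uv = (p : ℂ) ^ 4 * (p : ℂ) ^ n}.ncard = N₃ at *
    generalize {uv | E uv = -((p : ℂ) ^ 4 * (p : ℂ) ^ n)}.ncard = N₄ at *
    have hpQ : (1 : ℚ) < p := by exact_mod_cast hp1
    have res := frequencies_of_moments (p := p) (X := (p : ℚ) ^ n) (N₀ := N₀) (N₁ := N₁)
      (N₂ := N₂) (M₁ := N₃) (M₂ := N₄) hpQ (by positivity)
      (Rat.cast_injective (α := ℂ) (by push_cast; linear_combination -M0))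
      (Rat.cast_injective (α := ℂ) (by push_cast; linear_combination -M1))
      (Rat.cast_injective (α := ℂ) (by push_cast; linear_combination -M2))
      (Rat.cast_injective (α := ℂ) (by push_cast; linear_combination -M3))
      (Rat.cast_injective (α := ℂ) (by push_cast; linear_combination -M4))
    obtain ⟨r0, r1, r2, r3, r4⟩ := res
    refine ⟨?_, ?_, ?_, ?_, ?_⟩
    · rw [r0]; ring
    · rw [r1]; ring
    · rw [r2]; ring
    · rw [r3]; ring
    · rw [r4]; ring
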